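/- For integers $n\ge 1$ and $m\ge 0$ let $I_{n,m}$ denote the number of permutations $p=(p_1,\dots,p_n)$ of $\{1,\dots,n\}$ with exactly $m$ inversions, i.e. with exactly $m$ pairs $i<j$ such that $p_i>p_j$. There is an absolute constant $C$ such that the following holds. Let $m=m(n)$ be a sequence of non-negative integers such that, as $n\to\infty$, $m/n\to\infty$ and $m=o(n^{3/2})$. Then there is a sequence of real numbers $E_n$ with $|E_n|\le C\log n$ for all sufficiently large $n$, such that for all sufficiently large $n$ $$I_{n,m}\ \ge\ \binom{n+m-1}{n-1}\exp\left(-\frac{\pi^2 m}{6n}+E_n\right);$$ that is, $I_{n,m}\ge \binom{n+m-1}{n-1}\exp\left(-\frac{\pi^2m}{6n}+O(\log n)\right)$, where the constant in $O(\log n)$ does not depend on the sequence $m(n)$ (while the meaning of "sufficiently large" may). -/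

import Mathlib

open Filter Asymptotics

/-- The number of inversions of a permutation `p = (p₁, …, pₙ)`: the number of pairs of positions
`i < j` with `pᵢ > pⱼ`. -/
def inversionCount {n : ℕ} (p : Equiv.Perm (Fin n)) : ℕ :=
  (Finset.univ.filter fun ij : Fin n × Fin n => ij.1 < ij.2 ∧ p ij.2 < p ij.1).card

/-- `I_{n,m}`: the number of permutations of an `n`-element linearly ordered set
with exactly `m` inversions. -/
def numPermsWithInversions (n m : ℕ) : ℕ :=
  (Finset.univ.filter fun p : Equiv.Perm (Fin n) => inversionCount p = m).card

/-! The coefficients of P(z) = ∏_{j ≤ n} (1 + ⋯ + z^(j-1)) = ∑ I_{n,k} z^k are log-concave, so for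
some z > 0 the term I_{n,m} z^m is the largest and P(z) ≤ (n² + 1) I_{n,m} z^m
(`exists_inversionGF_le`). This z need not be located: `le_log_inversionGF_sub` bounds P(z) z^(-m)
below for every z > 0. For z < 1, P(z) = (1 - z)^(-n) ∏ (1 - z^j). The product costs at most
(π²/6)/(1 - z) in the logarithm. The factor (1 - z)^(-n) z^(-m) is least at z = m/(n+m), where it is
at least the binomial coefficient and the cost is (π²/6)(m/n + 1). Elsewhere convexity outweighs any
extra cost, since (m/n)² is small against n. -/

/-- The permutation of `Fin (n + 1)` sending `0` to `p` whose remaining values have the same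
relative order as those of `e`. -/
noncomputable def permCons {n : ℕ} (p : Fin (n + 1)) (e : Equiv.Perm (Fin n)) :
    Equiv.Perm (Fin (n + 1)) :=
  Equiv.ofBijective (Fin.cons p (fun i => p.succAbove (e i)) : Fin (n + 1) → Fin (n + 1))
    (Finite.injective_iff_bijective.1 (by
      rw [Fin.cons_injective_iff]
      refine ⟨?_, Fin.succAbove_right_injective.comp e.injective⟩
      rintro ⟨i, hi⟩
      exact Fin.succAbove_ne _ _ hi))

@[simp] theorem permCons_zero {n : ℕ} (p : Fin (n + 1)) (e : Equiv.Perm (Fin n)) :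
    permCons p e 0 = p := rfl

@[simp] theorem permCons_succ {n : ℕ} (p : Fin (n + 1)) (e : Equiv.Perm (Fin n)) (i : Fin n) :
    permCons p e i.succ = p.succAbove (e i) := rfl

theorem permCons_bijective (n : ℕ) :
    Function.Bijective (fun x : Fin (n + 1) × Equiv.Perm (Fin n) => permCons x.1 x.2) := by
  rw [Fintype.bijective_iff_injective_and_card]
  constructor
  · rintro ⟨p, e⟩ ⟨q, f⟩ h
    have h0 : p = q := by simpa using congrArg (fun s => s 0) h
    subst h0
    have : e = f := by
      ext i
      have := congrArg (fun s => s i.succ) h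
      simp only [permCons_succ] at this
      rw [Fin.succAbove_right_injective this]
    rw [this]
  · simp [Fintype.card_perm, Nat.factorial_succ]

theorem inversionCount_eq_sum {n : ℕ} (p : Equiv.Perm (Fin n)) :
    inversionCount p = ∑ i, ∑ j, if i < j ∧ p j < p i then 1 else 0 := by
  rw [inversionCount, Finset.card_filter, Fintype.sum_prod_type]

theorem sum_ite_succAbove_lt {n : ℕ} (p : Fin (n + 1)) :
    (∑ i : Fin n, if p.succAbove i < p then 1 else 0) = (p : ℕ) := by
  simp only [Fin.succAbove_lt_iff_castSucc_lt]
  simp only [Fin.lt_def, Fin.val_castSucc]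
  rw [← Finset.sum_range (fun i => if i < (p : ℕ) then 1 else 0), ← Finset.card_filter]
  have : (Finset.range n).filter (· < (p : ℕ)) = Finset.range p := by
    ext i
    simp only [Finset.mem_filter, Finset.mem_range]
    omega
  rw [this, Finset.card_range]

/-- The first entry `p` exceeds exactly `p` later values, and `succAbove` preserves the order of the
rest. -/
theorem inversionCount_permCons {n : ℕ} (p : Fin (n + 1)) (e : Equiv.Perm (Fin n)) :
    inversionCount (permCons p e) = p + inversionCount e := by
  rw [inversionCount_eq_sum, inversionCount_eq_sum, Fin.sum_univ_succ]
  congr 1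
  · rw [Fin.sum_univ_succ]
    simp only [lt_self_iff_false, false_and, if_false, zero_add, Fin.succ_pos, true_and,
      permCons_zero, permCons_succ]
    rw [Equiv.sum_comp e (fun i => if p.succAbove i < p then 1 else 0), sum_ite_succAbove_lt]
  · refine Finset.sum_congr rfl fun i _ => ?_
    rw [Fin.sum_univ_succ]
    simp [Fin.succAbove_lt_succAbove_iff]

theorem sum_perm_succ {M : Type*} [AddCommMonoid M] (n : ℕ) (f : ℕ → M) :
    ∑ σ : Equiv.Perm (Fin (n + 1)), f (inversionCount σ) =
      ∑ l ∈ Finset.range (n + 1), ∑ e : Equiv.Perm (Fin n), f (l + inversionCount e) := by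
  rw [← (permCons_bijective n).sum_comp (fun σ => f (inversionCount σ)), Fintype.sum_prod_type,
    Finset.sum_range (fun l => ∑ e : Equiv.Perm (Fin n), f (l + inversionCount e))]
  simp only [inversionCount_permCons]

theorem inversionCount_le {n : ℕ} (p : Equiv.Perm (Fin n)) : inversionCount p ≤ n ^ 2 := by
  refine (Finset.card_le_univ _).trans ?_
  simp [sq]

/-- The number of permutations of `Fin n` with `k` inversions, extended by zero to all integers. -/
noncomputable def inversionCoeff (n : ℕ) (k : ℤ) : ℝ :=
  ∑ σ : Equiv.Perm (Fin n), if (inversionCount σ : ℤ) = k then 1 else 0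

theorem inversionCoeff_natCast (n m : ℕ) :
    inversionCoeff n m = numPermsWithInversions n m := by
  simp [inversionCoeff, numPermsWithInversions]

theorem inversionCoeff_nonneg (n : ℕ) (k : ℤ) : 0 ≤ inversionCoeff n k :=
  Finset.sum_nonneg fun _ _ => by split_ifs <;> norm_num

theorem inversionCoeff_succ (n : ℕ) (k : ℤ) :
    inversionCoeff (n + 1) k = ∑ l ∈ Finset.range (n + 1), inversionCoeff n (k - l) := by
  rw [inversionCoeff, sum_perm_succ n (fun i : ℕ => if (i : ℤ) = k then (1 : ℝ) else 0)]
  refine Finset.sum_congr rfl fun l _ => Finset.sum_congr rfl fun e _ => ?_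
  congr 1
  push_cast
  rw [eq_sub_iff_add_eq, add_comm]

theorem inversionCoeff_zero (k : ℤ) : inversionCoeff 0 k = if k = 0 then 1 else 0 := by
  have h (σ : Equiv.Perm (Fin 0)) : inversionCount σ = 0 := Nat.le_zero.1 (inversionCount_le σ)
  simp [inversionCoeff, h, eq_comm]

theorem inversionCoeff_pos (n k : ℕ) (h : 2 * k ≤ n * (n - 1)) : 0 < inversionCoeff n k := by
  induction n generalizing k with
  | zero =>
    obtain rfl : k = 0 := by omega
    simp [inversionCoeff_zero]
  | succ n ih =>
    rw [inversionCoeff_succ]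
    refine Finset.sum_pos' (fun _ _ => inversionCoeff_nonneg _ _)
      -- Greedy choice: the first entry takes as many inversions as it can.
      ⟨min k n, by simp, ?_⟩
    have : (k : ℤ) - (min k n : ℕ) = (k - min k n : ℕ) := by omega
    rw [this]
    apply ih
    rcases le_total k n with hk | hk
    · simp [hk]
    · rw [min_eq_right hk]
      cases n with
      | zero => omega
      | succ n =>
        simp only [Nat.add_sub_cancel] at h ⊢
        have : 2 * k ≤ 2 * (n + 1) + (n + 1) * n := by nlinarith
        omega

/-! ### Log-concavity and geometric tilts -/

/-- Log-concavity of a sequence indexed by the integers, in the form that also excludes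
internal zeros. -/
def IsLogConcave (a : ℤ → ℝ) : Prop := ∀ i j, i ≤ j → a i * a (j + 1) ≤ a (i + 1) * a j

theorem IsLogConcave.mul_le {a : ℤ → ℝ} (h : IsLogConcave a) (s : ℕ) {i j : ℤ} (hij : i ≤ j) :
    a i * a (j + s) ≤ a (i + s) * a j := by
  induction s generalizing i with
  | zero => simp
  | succ s ih =>
    rcases hij.eq_or_lt with rfl | hlt
    · rw [mul_comm]
    · push_cast
      have h1 := h i (j + s) (by omega)
      have h2 := ih (i := i + 1) (by omega)
      rw [show j + ((s : ℤ) + 1) = j + s + 1 by ring, show i + ((s : ℤ) + 1) = i + 1 + s by ring]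
      exact h1.trans h2

/-- Window sums of a log-concave sequence are log-concave. -/
theorem IsLogConcave.sum_range {a : ℤ → ℝ} (h : IsLogConcave a) (w : ℕ) :
    IsLogConcave (fun k => ∑ l ∈ Finset.range w, a (k - l)) := by
  intro i j hij
  cases w with
  | zero => simp
  | succ v =>
    have split_last (k : ℤ) : ∑ l ∈ Finset.range (v + 1), a (k - l) =
        ∑ l ∈ Finset.range v, a (k - l) + a (k - v) := Finset.sum_range_succ _ _
    have split_first (k : ℤ) : ∑ l ∈ Finset.range (v + 1), a (k + 1 - l) =
        ∑ l ∈ Finset.range v, a (k - l) + a (k + 1) := by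
      rw [Finset.sum_range_succ']
      simp
    simp only [split_last i, split_last j, split_first]
    -- After expansion the products of the two common sums cancel; the three remaining pairs of
    -- terms compare separately.
    have h1 : (∑ l ∈ Finset.range v, a (i - l)) * a (j + 1) ≤
        a (i + 1) * ∑ l ∈ Finset.range v, a (j - l) := by
      rw [Finset.sum_mul, Finset.mul_sum]
      refine Finset.sum_le_sum fun l _ => ?_
      have := h.mul_le (l + 1) (i := i - l) (j := j - l) (by omega)
      push_cast at this
      rwa [show j - (l : ℤ) + (l + 1) = j + 1 by ring,
        show i - (l : ℤ) + (l + 1) = i + 1 by ring] at this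
    have h2 : a (i - v) * (∑ l ∈ Finset.range v, a (j - l)) ≤
        (∑ l ∈ Finset.range v, a (i - l)) * a (j - v) := by
      rw [Finset.sum_mul, Finset.mul_sum]
      refine Finset.sum_le_sum fun l hl => ?_
      have hl := Finset.mem_range.1 hl
      have := h.mul_le (v - l) (i := i - v) (j := j - v) (by omega)
      rwa [show j - (v : ℤ) + (v - l : ℕ) = j - l by omega,
        show i - (v : ℤ) + (v - l : ℕ) = i - l by omega] at this
    have h3 : a (i - v) * a (j + 1) ≤ a (i + 1) * a (j - v) := by
      have := h.mul_le (v + 1) (i := i - v) (j := j - v) (by omega)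
      push_cast at this
      rwa [show j - (v : ℤ) + (v + 1) = j + 1 by ring,
        show i - (v : ℤ) + (v + 1) = i + 1 by ring] at this
    linarith

theorem isLogConcave_inversionCoeff (n : ℕ) : IsLogConcave (inversionCoeff n) := by
  induction n with
  | zero =>
    intro i j hij
    simp only [inversionCoeff_zero]
    split_ifs <;> first | omega | norm_num
  | succ n ih =>
    have := ih.sum_range (n + 1)
    simpa only [← inversionCoeff_succ] using this

/-- Every positive entry of a log-concave sequence followed by a positive entry is the maximum of
a geometric tilt. -/
theorem IsLogConcave.exists_tilt {a : ℤ → ℝ} (h : IsLogConcave a) {m : ℕ} (hm : 0 < a m)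
    (hm' : 0 < a (m + 1)) : ∃ z : ℝ, 0 < z ∧ ∀ k : ℕ, a k * z ^ k ≤ a m * z ^ m := by
  -- This ratio makes the tilted terms at m and m + 1 equal, so by log-concavity the tilted sequence
  -- peaks there.
  refine ⟨a m / a (m + 1), div_pos hm hm', fun k => ?_⟩
  set z := a m / a (m + 1) with hz
  have hz0 : 0 < z := div_pos hm hm'
  have hzm : z * a (m + 1) = a m := div_mul_cancel₀ _ hm'.ne'
  rcases le_total m k with hk | hk
  · induction k, hk using Nat.le_induction with
    | base => rfl
    | succ k hk ih =>
      refine le_trans ?_ ih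
      have h1 := h m k (by omega)
      have : a (k + 1) * z ≤ a k := by
        rw [← mul_le_mul_iff_left₀ hm']
        calc a (k + 1) * z * a (m + 1) = a m * a (k + 1) := by rw [mul_assoc, hzm]; ring
          _ ≤ a k * a (m + 1) := by linarith
      push_cast
      rw [pow_succ', ← mul_assoc]
      gcongr
  · induction hk using Nat.decreasingInduction with
    | self => rfl
    | of_succ k hk ih =>
      refine le_trans ?_ ih
      have h1 := h k m (by omega)
      have : a k ≤ a (k + 1) * z := by
        rw [← mul_le_mul_iff_left₀ hm']
        calc a k * a (m + 1) ≤ a (k + 1) * a m := h1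
          _ = _ := by rw [mul_assoc, hzm]
      push_cast
      rw [pow_succ', ← mul_assoc]
      gcongr

/-! ### Bounds for the generating function -/

/-- The inversion generating function. -/
noncomputable def inversionGF (n : ℕ) (z : ℝ) : ℝ :=
  ∏ j ∈ Finset.range n, ∑ i ∈ Finset.range (j + 1), z ^ i

theorem sum_pow_inversionCount (n : ℕ) (z : ℝ) :
    ∑ σ : Equiv.Perm (Fin n), z ^ inversionCount σ = inversionGF n z := by
  induction n with
  | zero =>
    have h (σ : Equiv.Perm (Fin 0)) : inversionCount σ = 0 := Nat.le_zero.1 (inversionCount_le σ)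
    simp [inversionGF, h]
  | succ n ih =>
    rw [sum_perm_succ n (fun i => z ^ i), inversionGF, Finset.prod_range_succ, ← inversionGF, ← ih,
      Finset.sum_mul_sum, Finset.sum_comm]
    simp only [pow_add, mul_comm]

theorem inversionGF_eq_sum (n : ℕ) (z : ℝ) :
    inversionGF n z = ∑ k ∈ Finset.range (n ^ 2 + 1), inversionCoeff n k * z ^ k := by
  simp only [inversionCoeff, Finset.sum_mul]
  rw [Finset.sum_comm, ← sum_pow_inversionCount]
  refine Finset.sum_congr rfl fun σ _ => ?_
  have := inversionCount_le σ
  simp only [Nat.cast_inj, ite_mul, one_mul, zero_mul]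
  rw [Finset.sum_ite_eq, if_pos (by simp; omega)]

theorem exists_inversionGF_le (n m : ℕ) (h : 2 * (m + 1) ≤ n * (n - 1)) :
    ∃ z : ℝ, 0 < z ∧
      inversionGF n z ≤ (n ^ 2 + 1) * (numPermsWithInversions n m * z ^ m) := by
  obtain ⟨z, hz, hk⟩ := (isLogConcave_inversionCoeff n).exists_tilt
    (inversionCoeff_pos n m (by omega)) (by exact_mod_cast inversionCoeff_pos n (m + 1) h)
  refine ⟨z, hz, ?_⟩
  rw [inversionGF_eq_sum]
  refine (Finset.sum_le_card_nsmul _ _ _ fun k _ => hk k).trans ?_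
  simp [inversionCoeff_natCast]

/-- Each factor is palindromic. This reduces z > 1 to z < 1. -/
theorem inversionGF_inv (n : ℕ) {z : ℝ} (hz : 0 < z) :
    inversionGF n z = z ^ (∑ j ∈ Finset.range n, j) * inversionGF n z⁻¹ := by
  rw [inversionGF, inversionGF, ← Finset.prod_pow_eq_pow_sum, ← Finset.prod_mul_distrib]
  refine Finset.prod_congr rfl fun j _ => ?_
  rw [Finset.mul_sum, ← Finset.sum_range_reflect]
  refine Finset.sum_congr rfl fun i hi => ?_
  have hi := Finset.mem_range.1 hi
  rw [inv_pow, ← div_eq_mul_inv, eq_div_iff (by positivity), ← pow_add]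
  congr 1
  omega

theorem inversionGF_mono (n : ℕ) {y z : ℝ} (hy : 0 ≤ y) (h : y ≤ z) :
    inversionGF n y ≤ inversionGF n z := by
  unfold inversionGF
  gcongr

/-- Expanding the logarithms and summing over j first leaves terms z^k / (k(1 - z^k)). Since 1 - z^k
≥ k z^k (1 - z), each is at most 1/(k²(1 - z)), and ζ(2) = π²/6. -/
theorem sum_neg_log_one_sub_pow_le (n : ℕ) {z : ℝ} (h0 : 0 < z) (h1 : z < 1) :
    ∑ j ∈ Finset.range n, -Real.log (1 - z ^ (j + 1)) ≤ Real.pi ^ 2 / 6 * (1 - z)⁻¹ := by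
  have hlog (j : ℕ) (_ : j ∈ Finset.range n) :
      HasSum (fun k : ℕ => (z ^ (j + 1)) ^ (k + 1) / ((k : ℝ) + 1))
        (-Real.log (1 - z ^ (j + 1))) := by
    apply Real.hasSum_pow_div_log_of_abs_lt_one
    rw [abs_of_pos (by positivity)]
    exact pow_lt_one₀ h0.le h1 (by omega)
  have hz : HasSum (fun k : ℕ => 1 / ((k : ℝ) + 1) ^ 2) (Real.pi ^ 2 / 6) := by
    have := (hasSum_nat_add_iff' (f := fun k : ℕ => 1 / (k : ℝ) ^ 2) 1).2 hasSum_zeta_two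
    simpa using this
  refine hasSum_le (fun k => ?_) (hasSum_sum hlog) (hz.mul_right (1 - z)⁻¹)
  have hu : 0 < 1 - z := by linarith
  have hw0 : 0 < z ^ (k + 1) := by positivity
  have hw1 : z ^ (k + 1) < 1 := pow_lt_one₀ h0.le h1 (by omega)
  have hgeom : ∑ j ∈ Finset.range n, (z ^ (j + 1)) ^ (k + 1) ≤
      z ^ (k + 1) / (1 - z ^ (k + 1)) := by
    have : ∑ j ∈ Finset.range n, (z ^ (j + 1)) ^ (k + 1) =
        z ^ (k + 1) * ∑ j ∈ Finset.range n, (z ^ (k + 1)) ^ j := by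
      rw [Finset.mul_sum]
      refine Finset.sum_congr rfl fun j _ => ?_
      rw [← pow_mul, ← pow_mul, ← pow_add]
      ring_nf
    rw [this, div_eq_mul_inv, ← tsum_geometric_of_lt_one hw0.le hw1]
    gcongr
    exact (summable_geometric_of_lt_one hw0.le hw1).sum_le_tsum _ fun _ _ => by positivity
  have hpow : ((k : ℝ) + 1) * z ^ (k + 1) * (1 - z) ≤ 1 - z ^ (k + 1) := by
    have hs : ((k : ℝ) + 1) * z ^ (k + 1) ≤ ∑ i ∈ Finset.range (k + 1), z ^ i := by
      have := Finset.card_nsmul_le_sum (Finset.range (k + 1)) (fun i => z ^ i) (z ^ (k + 1))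
        fun i hi => pow_le_pow_of_le_one h0.le h1.le (Finset.mem_range.1 hi).le
      simpa using this
    have hg := geom_sum_mul_neg z (k + 1)
    nlinarith
  rw [← Finset.sum_div]
  calc (∑ j ∈ Finset.range n, (z ^ (j + 1)) ^ (k + 1)) / ((k : ℝ) + 1)
      ≤ z ^ (k + 1) / (1 - z ^ (k + 1)) / ((k : ℝ) + 1) := by gcongr
    _ ≤ ((k + 1 : ℝ) * (1 - z))⁻¹ / ((k : ℝ) + 1) := by
        gcongr
        rw [div_le_iff₀ (by linarith), inv_mul_eq_div, le_div_iff₀ (by positivity)]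
        linarith
    _ = 1 / ((k : ℝ) + 1) ^ 2 * (1 - z)⁻¹ := by
        field_simp

theorem inversionGF_pos (n : ℕ) {z : ℝ} (h0 : 0 < z) : 0 < inversionGF n z :=
  Finset.prod_pos fun _ _ => Finset.sum_pos (fun _ _ => by positivity) (by simp)

theorem le_log_inversionGF (n : ℕ) {z : ℝ} (h0 : 0 < z) (h1 : z < 1) :
    -(n * Real.log (1 - z)) - Real.pi ^ 2 / 6 * (1 - z)⁻¹ ≤ Real.log (inversionGF n z) := by
  have hu : 0 < 1 - z := by linarith
  have hfac (j : ℕ) : Real.log (∑ i ∈ Finset.range (j + 1), z ^ i) =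
      Real.log (1 - z ^ (j + 1)) - Real.log (1 - z) := by
    have : 0 < 1 - z ^ (j + 1) := by linarith [pow_lt_one₀ h0.le h1 (n := j + 1) (by omega)]
    rw [← Real.log_div this.ne' hu.ne', ← geom_sum_mul_neg, mul_div_cancel_right₀ _ hu.ne']
  rw [inversionGF, Real.log_prod (fun j _ =>
    (Finset.sum_pos (fun _ _ => by positivity) (by simp)).ne')]
  simp only [hfac, Finset.sum_sub_distrib, Finset.sum_const, Finset.card_range, nsmul_eq_mul]
  have := sum_neg_log_one_sub_pow_le n h0 h1
  rw [Finset.sum_neg_distrib] at this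
  linarith

/-! ### Comparison with the binomial coefficient -/

/-- A single term of the expansion of (n/(n+m) + m/(n+m))^(n+m) = 1 is at most 1. -/
theorem log_choose_le {n m : ℕ} (hn : 0 < n) (hm : 0 < m) :
    Real.log ((n + m - 1).choose (n - 1)) ≤
      -(n * Real.log (n / (n + m))) - m * Real.log (m / (n + m)) := by
  have hn' : (0 : ℝ) < n := by exact_mod_cast hn
  have hm' : (0 : ℝ) < m := by exact_mod_cast hm
  have hc : 0 < (n + m - 1).choose (n - 1) := Nat.choose_pos (by omega)
  have hle : (n + m - 1).choose (n - 1) ≤ (n + m).choose n := by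
    obtain ⟨n, rfl⟩ := Nat.exists_eq_add_of_lt hn
    simp only [zero_add, Nat.add_sub_cancel]
    rw [show n + 1 + m = n + m + 1 by ring, Nat.choose_succ_succ]
    simp
  have hbin : ((n : ℝ) / (n + m)) ^ n * (m / (n + m)) ^ m * (n + m).choose n ≤ 1 := by
    have := add_pow ((n : ℝ) / (n + m)) (m / (n + m)) (n + m)
    rw [← add_div, div_self (by positivity), one_pow] at this
    rw [this]
    have := Finset.single_le_sum (f := fun k => ((n : ℝ) / (n + m)) ^ k *
      (m / (n + m)) ^ (n + m - k) * ((n + m).choose k)) (s := Finset.range (n + m + 1))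
      (fun k _ => by positivity) (Finset.mem_range.2 (by omega : n < n + m + 1))
    simpa using this
  have hbin' : ((n : ℝ) / (n + m)) ^ n * (m / (n + m)) ^ m * (n + m - 1).choose (n - 1) ≤ 1 := by
    refine le_trans ?_ hbin
    gcongr
  have hc' : (0 : ℝ) < (n + m - 1).choose (n - 1) := by exact_mod_cast hc
  have := Real.log_nonpos (by positivity) hbin'
  rw [Real.log_mul (by positivity) hc'.ne', Real.log_mul (by positivity) (by positivity),
    Real.log_pow, Real.log_pow] at this
  linarith

theorem add_sq_div_two_le_neg_log {d : ℝ} (h0 : 0 ≤ d) (h1 : d < 1) :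
    d + d ^ 2 / 2 ≤ -Real.log (1 - d) := by
  have := Real.hasSum_pow_div_log_of_abs_lt_one (x := d) (by rwa [abs_of_nonneg h0])
  have := sum_le_hasSum (Finset.range 2) (fun k _ => by positivity) this
  norm_num [Finset.sum_range_succ] at this
  linarith

/-- The loss `K * (Y / r - Y)` from moving off `r = 1` is absorbed by the strict convexity of
`r - 1 - log r`. -/
theorem neg_log_sub_ge {K N Y r : ℝ} (hK : 0 ≤ K) (hN : 0 < N) (hY : 0 ≤ Y) (hr : 1 / 8 ≤ r)
    (hbig : 32 * (K * Y) ^ 2 ≤ N) :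
    -(K * Y) - 1 ≤ -(N * Real.log r) - N * (1 - r) - K * (Y / r) := by
  have hr0 : 0 < r := by linarith
  rcases le_total 1 r with h | h
  · have h1 := Real.log_le_sub_one_of_pos hr0
    have h2 : Y / r ≤ Y := div_le_self hY h
    nlinarith [mul_le_mul_of_nonneg_left h1 hN.le, mul_le_mul_of_nonneg_left h2 hK]
  · have h1 := add_sq_div_two_le_neg_log (d := 1 - r) (by linarith) (by linarith)
    rw [sub_sub_cancel] at h1
    have h2 : Y / r ≤ Y + 8 * Y * (1 - r) := by
      rw [div_le_iff₀ hr0]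
      nlinarith [mul_nonneg (mul_nonneg hY (sub_nonneg.2 h)) (by linarith : (0 : ℝ) ≤ 8 * r - 1)]
    have h3 := mul_le_mul_of_nonneg_left h1 hN.le
    have h4 := mul_le_mul_of_nonneg_left h2 hK
    -- With A = N(1-r)²/2, `hbig` bounds the square of the left side by 4A ≤ (A + 1)².
    have h5 : 8 * (K * Y) * (1 - r) ≤ N * (1 - r) ^ 2 / 2 + 1 := by
      have : (8 * (K * Y) * (1 - r)) ^ 2 ≤ 2 * (N * (1 - r) ^ 2) := by
        nlinarith [mul_le_mul_of_nonneg_right hbig (sq_nonneg (1 - r))]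
      nlinarith [sq_nonneg (N * (1 - r) ^ 2 / 2 - 1), mul_nonneg hN.le (sq_nonneg (1 - r)),
        abs_le_of_sq_le_sq' (a := 8 * (K * Y) * (1 - r)) (b := N * (1 - r) ^ 2 / 2 + 1)
          (by nlinarith [sq_nonneg (N * (1 - r) ^ 2 / 2 - 1)])
          (by positivity)]
    nlinarith

theorem log_choose_le_log_inversionGF {n m : ℕ} (hn : 2 ≤ n) (hm : 0 < m)
    (hbig : 32 * (Real.pi ^ 2 / 6 * ((m : ℝ) / n + 1)) ^ 2 ≤ n) {z : ℝ} (h0 : 0 < z)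
    (h1 : z ≤ 1) :
    Real.log ((n + m - 1).choose (n - 1)) - Real.pi ^ 2 / 6 * ((m : ℝ) / n + 1) - 1 ≤
      Real.log (inversionGF n z) - m * Real.log z := by
  have hn' : (2 : ℝ) ≤ n := by exact_mod_cast hn
  have hn0 : (0 : ℝ) < n := by linarith
  have hm' : (0 : ℝ) < m := by exact_mod_cast hm
  have hC := log_choose_le (n := n) (m := m) (by omega) hm
  set K := Real.pi ^ 2 / 6 with hK
  have hK0 : 0 ≤ K := by positivity
  set Y := (m : ℝ) / n + 1 with hY
  have hY0 : 0 < Y := by positivity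
  have hu : (n : ℝ) / (n + m) = Y⁻¹ := by rw [hY]; field_simp; ring
  have hm1 : (m : ℝ) / (n + m) = 1 - Y⁻¹ := by rw [← hu]; field_simp; ring
  have hw : 0 < 1 - Y⁻¹ := by rw [← hm1]; positivity
  have hmn : m * Y⁻¹ = n * (1 - Y⁻¹) := by rw [← hu]; field_simp; ring
  rw [hu, hm1] at hC
  have hYi : 0 < Y⁻¹ := by positivity
  rcases le_total z (1 - Y⁻¹ / 8) with hz | hz
  · have hz1 : z < 1 := by linarith
    -- r measures 1 - z in units of its saddle value 1/Y = n/(n+m).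
    obtain ⟨r, hr⟩ : ∃ r, r = (1 - z) * Y := ⟨_, rfl⟩
    have hzr : 1 - z = r * Y⁻¹ := by rw [hr]; field_simp
    have hr8 : 1 / 8 ≤ r := by
      by_contra hcon
      nlinarith
    have hr0 : 0 < r := by linarith
    have hP := le_log_inversionGF n h0 hz1
    rw [hzr, Real.log_mul hr0.ne' hYi.ne', mul_inv, inv_inv, ← hK] at hP
    have hT := neg_log_sub_ge hK0 hn0 hY0.le hr8 hbig
    -- The tangent of log at the saddle; its n(1 - r) cancels the linear part of -n log r.
    have hL : m * Real.log z ≤ m * Real.log (1 - Y⁻¹) + n * (1 - r) := by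
      have h2 := Real.log_le_sub_one_of_pos (div_pos h0 hw)
      rw [Real.log_div h0.ne' hw.ne'] at h2
      have h3 : m * (z / (1 - Y⁻¹) - 1) = n * (1 - r) := by
        rw [div_sub_one hw.ne', mul_div_assoc', div_eq_iff hw.ne']
        linear_combination (1 - r) * hmn - m * hzr
      nlinarith [mul_le_mul_of_nonneg_left h2 hm'.le]
    have : K * (r⁻¹ * Y) = K * (Y / r) := by ring
    linarith
  -- Near 1, monotonicity gives the value at 1 - 1/(8Y). The gain n log 8 ≥ 2n pays for the cost 8KY
  -- ≤ n and for the lost m log z, worth at most n.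
  · have hY1 : Y⁻¹ < 1 := by linarith
    have hP := le_log_inversionGF n (z := 1 - Y⁻¹ / 8) (by linarith) (by linarith)
    rw [sub_sub_cancel, Real.log_div hYi.ne' (by norm_num), inv_div, div_inv_eq_mul, ← hK] at hP
    have hmono := Real.log_le_log (inversionGF_pos n (z := 1 - Y⁻¹ / 8) (by linarith))
      (inversionGF_mono n (by linarith) hz)
    have hlz : m * Real.log z ≤ 0 :=
      mul_nonpos_of_nonneg_of_nonpos hm'.le (Real.log_nonpos h0.le h1)
    have hlw : -(m * Real.log (1 - Y⁻¹)) ≤ n := by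
      have h2 := Real.one_sub_inv_le_log_of_pos hw
      have h3 : m * (1 - (1 - Y⁻¹)⁻¹) = -n := by
        refine mul_right_cancel₀ hw.ne' ?_
        rw [mul_assoc, sub_mul, inv_mul_cancel₀ hw.ne']
        linear_combination -hmn
      nlinarith [mul_le_mul_of_nonneg_left h2 hm'.le]
    have hl8 : 2 ≤ Real.log 8 := by
      rw [show (8 : ℝ) = 2 ^ 3 by norm_num, Real.log_pow]
      have := Real.log_two_gt_d9
      push_cast
      linarith
    have h8 : 8 * (K * Y) ≤ n := by nlinarith [mul_nonneg hK0 hY0.le]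
    have h9 := mul_le_mul_of_nonneg_left hl8 hn0.le
    have h10 := mul_nonneg hK0 hY0.le
    have h11 : K * (8 * Y) = 8 * (K * Y) := by ring
    linarith

theorem le_log_inversionGF_sub {n m : ℕ} (hn : 2 ≤ n) (hm : 0 < m) (hmn : 4 * m ≤ n * (n - 1))
    (hbig : 32 * (Real.pi ^ 2 / 6 * ((m : ℝ) / n + 1)) ^ 2 ≤ n) {z : ℝ} (h0 : 0 < z) :
    Real.log ((n + m - 1).choose (n - 1)) - Real.pi ^ 2 / 6 * ((m : ℝ) / n + 1) - 1 ≤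
      Real.log (inversionGF n z) - m * Real.log z := by
  rcases le_total z 1 with h1 | h1
  · exact log_choose_le_log_inversionGF hn hm hbig h0 h1
  · have h2 := log_choose_le_log_inversionGF hn hm hbig (inv_pos.2 h0) (inv_le_one_of_one_le₀ h1)
    rw [inversionGF_inv n h0, Real.log_mul (by positivity)
      (inversionGF_pos n (inv_pos.2 h0)).ne', Real.log_pow]
    rw [Real.log_inv] at h2
    -- The degree is at least 2m, so z^(degree - m) ≥ z^m for z ≥ 1.
    have h3 : 2 * m ≤ ∑ j ∈ Finset.range n, j := by
      have := Finset.sum_range_id_mul_two n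
      omega
    have h4 : (2 * m : ℝ) ≤ (∑ j ∈ Finset.range n, j : ℕ) := by exact_mod_cast h3
    nlinarith [mul_le_mul_of_nonneg_right h4 (Real.log_nonneg h1)]

theorem choose_mul_exp_le_numPermsWithInversions {n m : ℕ} (hn : 3 ≤ n) (hm : 0 < m)
    (hmn : 4 * m ≤ n * (n - 1))
    (hbig : 32 * (Real.pi ^ 2 / 6 * ((m : ℝ) / n + 1)) ^ 2 ≤ n) :
    ((n + m - 1).choose (n - 1) : ℝ) * Real.exp (-(Real.pi ^ 2 * m / (6 * n)) +
      -(Real.pi ^ 2 / 6 + 1 + Real.log (n ^ 2 + 1))) ≤ numPermsWithInversions n m := by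
  have hn0 : (0 : ℝ) < n := by exact_mod_cast (by omega : 0 < n)
  have hC : (0 : ℝ) < (n + m - 1).choose (n - 1) := by
    exact_mod_cast Nat.choose_pos (by omega)
  have hNM : 2 * (m + 1) ≤ n * (n - 1) := by
    have : 3 * 2 ≤ n * (n - 1) := Nat.mul_le_mul hn (by omega)
    omega
  obtain ⟨z, hz, hle⟩ := exists_inversionGF_le n m hNM
  have hI : (0 : ℝ) < numPermsWithInversions n m := by
    rw [← inversionCoeff_natCast]
    exact inversionCoeff_pos n m (by omega)
  have h1 := le_log_inversionGF_sub (by omega) hm hmn hbig hz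
  have h2 := Real.log_le_log (inversionGF_pos n hz) hle
  rw [Real.log_mul (by positivity) (by positivity), Real.log_mul hI.ne' (by positivity),
    Real.log_pow] at h2
  rw [← Real.log_le_log_iff (by positivity) hI, Real.log_mul hC.ne' (Real.exp_ne_zero _),
    Real.log_exp]
  have h3 : Real.pi ^ 2 * m / (6 * n) = Real.pi ^ 2 / 6 * ((m : ℝ) / n) := by field_simp
  rw [h3]
  linarith

theorem mainTheorem9 :
    ∃ C : ℝ, ∀ m : ℕ → ℕ,
      Tendsto (fun n : ℕ => (m n : ℝ) / (n : ℝ)) atTop atTop →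
      (fun n : ℕ => (m n : ℝ)) =o[atTop] (fun n : ℕ => (n : ℝ) ^ (3 / 2 : ℝ)) →
      ∃ E : ℕ → ℝ,
        IsBigOWith C atTop E (fun n : ℕ => Real.log (n : ℝ)) ∧
        ∀ᶠ n : ℕ in atTop,
          (numPermsWithInversions n (m n) : ℝ) ≥
            ((n + m n - 1).choose (n - 1) : ℝ) *
              Real.exp (-(Real.pi ^ 2 * (m n : ℝ) / (6 * (n : ℝ))) + E n) := by
  -- log(n² + 1) contributes 2 log n; the other 2 log n absorbs the constants.
  refine ⟨4, fun m hm1 hm2 =>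
    ⟨fun n => -(Real.pi ^ 2 / 6 + 1 + Real.log (n ^ 2 + 1)), ?_, ?_⟩⟩
  · rw [isBigOWith_iff]
    have hlog : Tendsto (fun n : ℕ => Real.log n) atTop atTop :=
      Real.tendsto_log_atTop.comp tendsto_natCast_atTop_atTop
    filter_upwards [hlog.eventually_ge_atTop 3, eventually_ge_atTop 1] with n hn hn1
    have hn1 : (1 : ℝ) ≤ n := by exact_mod_cast hn1
    have h1 : Real.log ((n : ℝ) ^ 2 + 1) ≤ 1 + 2 * Real.log n := by
      have : (n : ℝ) ^ 2 + 1 ≤ 2 * (n : ℝ) ^ 2 := by nlinarith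
      have h2 := Real.log_le_log (by positivity) this
      rw [Real.log_mul (by norm_num) (by positivity), Real.log_pow] at h2
      have := Real.log_two_lt_d9
      push_cast at h2
      linarith
    have h0 : 0 ≤ Real.log ((n : ℝ) ^ 2 + 1) := Real.log_nonneg (by nlinarith)
    have hpi : Real.pi ^ 2 ≤ 12 := by nlinarith [Real.pi_lt_d2, Real.pi_pos]
    rw [norm_neg, Real.norm_of_nonneg (by positivity), Real.norm_of_nonneg (by linarith)]
    linarith
  · have hpi : Real.pi ^ 2 / 6 ≤ 2 := by nlinarith [Real.pi_lt_d2, Real.pi_pos]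
    filter_upwards [hm1.eventually_ge_atTop 1, hm2.bound (show (0 : ℝ) < 1 / 32 by norm_num),
      eventually_ge_atTop 3] with n h1 h2 hn
    have hn' : (3 : ℝ) ≤ n := by exact_mod_cast hn
    have hn0 : (0 : ℝ) < n := by linarith
    rw [Real.norm_of_nonneg (by positivity), Real.norm_of_nonneg (by positivity)] at h2
    have hsq : ((n : ℝ) ^ (3 / 2 : ℝ)) ^ 2 = (n : ℝ) ^ 3 := by
      rw [← Real.rpow_natCast, ← Real.rpow_mul hn0.le, ← Real.rpow_natCast]
      norm_num
    have hm3 : (32 * (m n : ℝ)) ^ 2 ≤ (n : ℝ) ^ 3 := by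
      rw [← hsq]
      gcongr
      linarith
    have hX : 32 ^ 2 * ((m n : ℝ) / n) ^ 2 ≤ n := by
      rw [div_pow, mul_div_assoc', div_le_iff₀ (by positivity)]
      linarith
    have hm0 : (n : ℝ) ≤ m n := by rwa [le_div_iff₀ hn0, one_mul] at h1
    refine choose_mul_exp_le_numPermsWithInversions hn ?_ ?_ ?_
    · have : (0 : ℝ) < m n := by linarith
      exact_mod_cast this
    · have h16 : 8 * (m n : ℝ) ≤ (n : ℝ) ^ 2 := by
        refine abs_le_of_sq_le_sq' ?_ (by positivity) |>.2
        nlinarith [mul_nonneg (pow_nonneg hn0.le 3) (by linarith : (0 : ℝ) ≤ n - 1)]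
      have h17 : 8 * m n ≤ n ^ 2 := by exact_mod_cast h16
      obtain ⟨k, rfl⟩ := Nat.exists_eq_add_of_le hn
      simp only [show 3 + k - 1 = 2 + k by omega]
      nlinarith
    -- Here m/n ≥ 1 and π²/6 ≤ 2; then 32 · 4² ≤ 32², which is where 1/32 suffices.
    · have : (Real.pi ^ 2 / 6 * ((m n : ℝ) / n + 1)) ≤ 4 * ((m n : ℝ) / n) := by
        nlinarith [Real.pi_pos]
      calc 32 * (Real.pi ^ 2 / 6 * ((m n : ℝ) / n + 1)) ^ 2
          ≤ 32 * (4 * ((m n : ℝ) / n)) ^ 2 := by gcongr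
        _ ≤ (n : ℝ) := by nlinarith [sq_nonneg ((m n : ℝ) / n)]
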